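/- Let $E$ be a finite set and let $(X_t)_{t\ge 0}$ be an irreducible time-homogeneous continuous-time Markov chain on $E$ whose sample paths are almost surely right-continuous with left limits. Let $P_t=(P_t(i,j))_{i,j\in E}$ be its transition function, which is assumed honest ($\sum_j P_t(i,j)=1$) and standard ($P_t\to I$ as $t\to 0^+$), let $Q=\lim_{t\to0^+}(P_t-I)/t$ be its $Q$-matrix and let $\pi$ be its invariant probability distribution; write $\mathbb P_\pi$ for the law of the chain started from $X_0\sim\pi$. Put $\pi(f)=\sum_{i}\pi(i)f(i)$, $\langle f,h\rangle_\pi=\sum_i\pi(i)f(i)h(i)$ and $\|f\|_{\pi,2}=\langle f,f\rangle_\pi^{1/2}$ for real functions $f,h$ on $E$. Let $\mathcal A$ be the infinitesimal generator of $(P_t)$ on $L^2(\pi)$, that is, $\mathcal A f=\lim_{t\to0^+}(P_tf-f)/t$ in $L^2(\pi)$, with domain $\mathcal D(\mathcal A)$ the set of $f$ for which this limit exists, and let \[ \lambda(Q)=\inf\{-\langle \mathcal A f,f\rangle_\pi:\ f\in\mathcal D(\mathcal A),\ \|f\|_{\pi,2}=1,\ \pi(f)=0\}\in[-\infty,+\infty],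 \] with $\inf\emptyset=+\infty$. Then the chain admits an $L^2(\pi)$-spectral gap, i.e. $\lambda(Q)>0$, and for all real $a<b$, every function $g:E\to[a,b]$ and all $t,\varepsilon>0$, \[ \mathbb P_\pi\left(\frac1t\int_0^t g(X_s)\,\mathrm ds-\pi(g)\ge\varepsilon\right)\le\exp\left\{-\frac{\lambda(Q)\,t\,\varepsilon^2}{(b-a)^2}\right\}, \] where $e^{-\infty}=0$. -/

import Mathlib

open scoped NNReal Topology

namespace CTMC

/-- A standard (continuous at `0`), honest transition function on a finite state space. -/
structure IsTransitionFunction {E : Type*} [Fintype E] [DecidableEq E]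
    (P : ℝ≥0 → Matrix E E ℝ) : Prop where
  nonneg : ∀ t i j, 0 ≤ P t i j
  row_sum : ∀ t i, ∑ j, P t i j = 1
  zero : P 0 = 1
  add : ∀ s t, P (s + t) = P s * P t
  standard : ∀ i j, Filter.Tendsto (fun t => P t i j) (𝓝[>] 0) (𝓝 ((1 : Matrix E E ℝ) i j))

/-- `Q` is the `Q`-matrix (entrywise right derivative at time `0`) of `P`. -/
def HasQMatrix {E : Type*} [DecidableEq E]
    (P : ℝ≥0 → Matrix E E ℝ) (Q : Matrix E E ℝ) : Prop :=
  ∀ i j, Filter.Tendsto (fun t : ℝ≥0 => (P t i j - (1 : Matrix E E ℝ) i j) / (t : ℝ))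
    (𝓝[>] 0) (𝓝 (Q i j))

/-- Every state is reached from every state with positive probability. -/
def Irreducible {E : Type*} (P : ℝ≥0 → Matrix E E ℝ) : Prop :=
  ∀ i j, ∃ t, 0 < t ∧ 0 < P t i j

/-- `π` is an invariant probability distribution of `P`. -/
structure IsInvariantDistribution {E : Type*} [Fintype E]
    (P : ℝ≥0 → Matrix E E ℝ) (π : E → ℝ) : Prop where
  nonneg : ∀ i, 0 ≤ π i
  sum_eq_one : ∑ i, π i = 1
  invariant : ∀ t j, ∑ i, π i * P t i j = π j

/-- `X` is a time-homogeneous continuous-time Markov chain on `(Ω, μ)` with transition function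
`P` and initial distribution `ν`, with almost surely right-continuous paths having left limits
in the discrete space `E`. -/
structure IsMarkovChain {E Ω : Type*} [MeasurableSpace Ω] (μ : MeasureTheory.Measure Ω)
    (X : ℝ≥0 → Ω → E) (P : ℝ≥0 → Matrix E E ℝ) (ν : E → ℝ) : Prop where
  measurable : ∀ t i, MeasurableSet {ω | X t ω = i}
  initial : ∀ i, μ.real {ω | X 0 ω = i} = ν i
  /-- `P(X (tₙ + s) = j | X t₀ = i₀, …, X tₙ = iₙ) = P s iₙ j`, multiplied out. -/
  markov : ∀ (n : ℕ) (t : Fin (n + 1) → ℝ≥0) (i : Fin (n + 1) → E) (s : ℝ≥0) (j : E),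
    Monotone t →
      μ.real {ω | (∀ k, X (t k) ω = i k) ∧ X (t (Fin.last n) + s) ω = j} =
        μ.real {ω | ∀ k, X (t k) ω = i k} * P s (i (Fin.last n)) j
  cadlag : ∀ᵐ ω ∂μ,
    (∀ t, ∀ᶠ s in 𝓝[>] t, X s ω = X t ω) ∧
      ∀ t, 0 < t → ∃ j, ∀ᶠ s in 𝓝[<] t, X s ω = j

/-- The mean `π(f)`. -/
def mean {E : Type*} [Fintype E] (π f : E → ℝ) : ℝ := ∑ i, π i * f i

/-- The inner product of `L²(π)`. -/
def innerL2 {E : Type*} [Fintype E] (π f h : E → ℝ) : ℝ := ∑ i, π i * f i * h i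

/-- The norm of `L²(π)`. -/
noncomputable def normL2 {E : Type*} [Fintype E] (π f : E → ℝ) : ℝ := √(innerL2 π f f)

/-- `f` lies in the domain of the infinitesimal generator `𝒜` of `P` on `L²(π)`, and `𝒜 f = h`:
the quotients `(P t f - f) / t` converge to `h` in `L²(π)` as `t → 0+`. -/
def IsGeneratorAt {E : Type*} [Fintype E] (P : ℝ≥0 → Matrix E E ℝ) (π f h : E → ℝ) : Prop :=
  Filter.Tendsto
    (fun t : ℝ≥0 => normL2 π (fun i => ((∑ j, P t i j * f j) - f i) / (t : ℝ) - h i))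
    (𝓝[>] 0) (𝓝 0)

/-- The infimum of `-⟨𝒜 f, f⟩` over all `f` in the domain of `𝒜` with `‖f‖ = 1`, `π(f) = 0`,
taken in the extended reals (so it is `⊤` if there is no such `f`, i.e. on a one-point space). -/
noncomputable def spectralGap {E : Type*} [Fintype E] (P : ℝ≥0 → Matrix E E ℝ) (π : E → ℝ) :
    EReal :=
  sInf {c : EReal | ∃ f h : E → ℝ, IsGeneratorAt P π f h ∧ normL2 π f = 1 ∧ mean π f = 0 ∧
    c = ((-innerL2 π h f : ℝ) : EReal)}

end CTMC

namespace CTMC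

open Filter MeasureTheory

/-! Put v = θ(g − π(g)) with θ ≥ 0. By Markov's inequality the probability is at most e^{−θtε} E_π
exp(∫₀ᵗ v(X_s) ds). This expectation grows at rate at most L as soon as ⟨(Q + v)f, f⟩ ≤ L‖f‖² on
L²(π). Only the quadratic form matters, so reversibility plays no role.

For 0 < l ≤ λ(Q), the Dirichlet form −⟨Qf, f⟩ is at least l times the variance of f (`poincare`),
while ⟨(g − π(g))f, f⟩ is at most (b − a) times the norm times the standard deviation of f
(`sq_innerL2_mul_sub_le`). The AM-GM inequality then gives L = θ²(b − a)²/(4l) (`qForm_add_mul_le`),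
and θ = 2lε/(b − a)² yields the exponent.

The semigroup of Q + v is replaced by products of short steps f ↦ P_s(e^{sv} f), each of norm at
most e^{L's} for L' > L and small s (`eventually_weightedStep_le`). Iterates of such a step are
expectations of exponentials of Riemann sums (`IsMarkovChain.integral_prod`). Fatou's lemma passes
to the integral, and L' decreases to L.

The gap is positive because the Dirichlet form is a weighted sum of squared differences, which by
irreducibility vanishes only at constants; compactness of the unit sphere does the rest. -/

lemma HasQMatrix.nonneg_of_ne {E : Type*} [DecidableEq E] {P : ℝ≥0 → Matrix E E ℝ} {Q : Matrix E E ℝ}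
    (hQ : HasQMatrix P Q) (hP : ∀ t i j, 0 ≤ P t i j) {i j : E} (hij : i ≠ j) : 0 ≤ Q i j :=
  ge_of_tendsto' (hQ i j) fun t => by
    rw [Matrix.one_apply_ne hij, sub_zero]
    exact div_nonneg (hP t i j) t.2

variable {E : Type*} [Fintype E]

/-! ### Quadratic forms on `L²(π)` -/

lemma innerL2_self_eq_zero {π f : E → ℝ} (hπ : ∀ i, 0 < π i) (h : innerL2 π f f = 0) (i : E) :
    f i = 0 := by
  have h1 := (Finset.sum_eq_zero_iff_of_nonneg (f := fun i => π i * f i * f i)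
    (fun i _ => by rw [mul_assoc]; exact mul_nonneg (hπ i).le (mul_self_nonneg _))).1 h i
    (Finset.mem_univ i)
  have := (hπ i).ne'
  simpa [this] using h1

lemma innerL2_self_nonneg {π : E → ℝ} (hπ : ∀ i, 0 ≤ π i) (f : E → ℝ) : 0 ≤ innerL2 π f f :=
  Finset.sum_nonneg fun i _ => by rw [mul_assoc]; exact mul_nonneg (hπ i) (mul_self_nonneg _)

/-- The bilinear form `⟨Q f, h⟩` of `L²(π)`. -/
def qForm (Q : Matrix E E ℝ) (π f h : E → ℝ) : ℝ := innerL2 π (fun i => ∑ j, Q i j * f j) h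

/-- After expanding the square, the f(i)² terms cancel by the zero row sums and the f(j)² terms by
invariance of π. -/
lemma qForm_self {Q : Matrix E E ℝ} {π : E → ℝ} (hrow : ∀ i, ∑ j, Q i j = 0)
    (hinv : ∀ j, ∑ i, π i * Q i j = 0) (f : E → ℝ) :
    -qForm Q π f f = (∑ i, ∑ j, π i * Q i j * (f i - f j) ^ 2) / 2 := by
  have h1 : ∑ i, ∑ j, π i * Q i j * (f i) ^ 2 = 0 :=
    Finset.sum_eq_zero fun i _ => by rw [← Finset.sum_mul, ← Finset.mul_sum, hrow]; simp
  have h2 : ∑ i, ∑ j, π i * Q i j * (f j) ^ 2 = 0 := by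
    rw [Finset.sum_comm]
    exact Finset.sum_eq_zero fun j _ => by rw [← Finset.sum_mul, hinv]; simp
  have h3 : qForm Q π f f = ∑ i, ∑ j, π i * Q i j * (f i * f j) :=
    Finset.sum_congr rfl fun i _ => by
      rw [Finset.mul_sum, Finset.sum_mul]
      exact Finset.sum_congr rfl fun j _ => by ring
  have h4 : ∑ i, ∑ j, π i * Q i j * (f i - f j) ^ 2 =
      (∑ i, ∑ j, π i * Q i j * (f i) ^ 2) + (∑ i, ∑ j, π i * Q i j * (f j) ^ 2) -
        2 * ∑ i, ∑ j, π i * Q i j * (f i * f j) := by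
    simp only [Finset.mul_sum, ← Finset.sum_add_distrib, ← Finset.sum_sub_distrib]
    exact Finset.sum_congr rfl fun i _ => Finset.sum_congr rfl fun j _ => by ring
  rw [h4, h1, h2, h3]; ring

lemma qForm_sub_const {Q : Matrix E E ℝ} {π : E → ℝ} (hrow : ∀ i, ∑ j, Q i j = 0)
    (hinv : ∀ j, ∑ i, π i * Q i j = 0) (f : E → ℝ) (c : ℝ) :
    qForm Q π (fun i => f i - c) (fun i => f i - c) = qForm Q π f f := by
  rw [← neg_inj, qForm_self hrow hinv, qForm_self hrow hinv]
  simp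

lemma qForm_neg_nonneg {Q : Matrix E E ℝ} {π : E → ℝ} (hπ : ∀ i, 0 < π i)
    (hrow : ∀ i, ∑ j, Q i j = 0) (hinv : ∀ j, ∑ i, π i * Q i j = 0)
    (hoff : ∀ i j, i ≠ j → 0 ≤ Q i j) (f : E → ℝ) : 0 ≤ -qForm Q π f f := by
  rw [qForm_self hrow hinv]
  refine div_nonneg (Finset.sum_nonneg fun i _ => Finset.sum_nonneg fun j _ => ?_) zero_le_two
  rcases eq_or_ne i j with rfl | hij
  · simp
  · exact mul_nonneg (mul_nonneg (hπ i).le (hoff i j hij)) (sq_nonneg _)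

/-! ### The invariant distribution and the `Q`-matrix -/

lemma IsInvariantDistribution.pos {P : ℝ≥0 → Matrix E E ℝ} {π : E → ℝ}
    (hπ : IsInvariantDistribution P π) (hP : ∀ t i j, 0 ≤ P t i j) (hirr : Irreducible P)
    (j : E) : 0 < π j := by
  obtain ⟨i, hi⟩ : ∃ i, 0 < π i := by
    by_contra! h
    have h1 := hπ.sum_eq_one
    have h2 : ∑ i, π i ≤ 0 := Finset.sum_nonpos fun i _ => h i
    linarith
  obtain ⟨t, -, ht⟩ := hirr i j
  rw [← hπ.invariant t j]
  exact (mul_pos hi ht).trans_le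
    (Finset.single_le_sum (f := fun i => π i * P t i j)
      (fun k _ => mul_nonneg (hπ.nonneg k) (hP t k j)) (Finset.mem_univ i))

variable [DecidableEq E]

lemma HasQMatrix.row_sum {P : ℝ≥0 → Matrix E E ℝ} {Q : Matrix E E ℝ}
    (hQ : HasQMatrix P Q) (hP : ∀ t i, ∑ j, P t i j = 1) (i : E) : ∑ j, Q i j = 0 := by
  refine tendsto_nhds_unique (tendsto_finsetSum _ fun j _ => hQ i j) ?_
  refine tendsto_const_nhds.congr fun t => ?_
  rw [← Finset.sum_div, Finset.sum_sub_distrib, hP]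
  simp [Matrix.one_apply]

lemma HasQMatrix.invariant {P : ℝ≥0 → Matrix E E ℝ} {Q : Matrix E E ℝ} {π : E → ℝ}
    (hQ : HasQMatrix P Q) (hπ : IsInvariantDistribution P π) (j : E) :
    ∑ i, π i * Q i j = 0 := by
  refine tendsto_nhds_unique
    (tendsto_finsetSum _ fun i _ => (hQ i j).const_mul (π i)) ?_
  refine tendsto_const_nhds.congr fun t => ?_
  simp_rw [mul_div_assoc', mul_sub]
  rw [← Finset.sum_div, Finset.sum_sub_distrib, hπ.invariant]
  simp [Matrix.one_apply]

lemma HasQMatrix.tendsto_quotient {P : ℝ≥0 → Matrix E E ℝ} {Q : Matrix E E ℝ}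
    (hQ : HasQMatrix P Q) (f : E → ℝ) (i : E) :
    Tendsto (fun t : ℝ≥0 => ((∑ j, P t i j * f j) - f i) / (t : ℝ)) (𝓝[>] 0)
      (𝓝 (∑ j, Q i j * f j)) := by
  refine (tendsto_finsetSum _ fun j _ => (hQ i j).mul_const (f j)).congr fun t => ?_
  simp_rw [div_mul_eq_mul_div, sub_mul]
  rw [← Finset.sum_div, Finset.sum_sub_distrib]
  simp [Matrix.one_apply]

lemma HasQMatrix.tendsto_normL2 {P : ℝ≥0 → Matrix E E ℝ} {Q : Matrix E E ℝ}
    (hQ : HasQMatrix P Q) (π f h : E → ℝ) :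
    Tendsto (fun t : ℝ≥0 => normL2 π (fun i => ((∑ j, P t i j * f j) - f i) / (t : ℝ) - h i))
      (𝓝[>] 0) (𝓝 (normL2 π (fun i => (∑ j, Q i j * f j) - h i))) := by
  refine (Real.continuous_sqrt.tendsto _).comp (tendsto_finsetSum _ fun i _ => ?_)
  have := (hQ.tendsto_quotient f i).sub_const (h i)
  exact (this.const_mul (π i)).mul this

lemma HasQMatrix.isGeneratorAt {P : ℝ≥0 → Matrix E E ℝ} {Q : Matrix E E ℝ}
    (hQ : HasQMatrix P Q) (π f : E → ℝ) : IsGeneratorAt P π f (fun i => ∑ j, Q i j * f j) := by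
  have := hQ.tendsto_normL2 π f (fun i => ∑ j, Q i j * f j)
  simpa [normL2, innerL2, IsGeneratorAt] using this

/-- As π charges every point, `normL2` separates functions, so limits in L²(π) are unique and the
generator is Q itself. -/
lemma IsGeneratorAt.eq {P : ℝ≥0 → Matrix E E ℝ} {Q : Matrix E E ℝ} {π f h : E → ℝ}
    (hf : IsGeneratorAt P π f h) (hQ : HasQMatrix P Q) (hπ : ∀ i, 0 < π i) :
    h = fun i => ∑ j, Q i j * f j := by
  have h1 := tendsto_nhds_unique (hQ.tendsto_normL2 π f h) hf
  rw [normL2, Real.sqrt_eq_zero (innerL2_self_nonneg (fun i => (hπ i).le) _)] at h1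
  ext i
  linarith [innerL2_self_eq_zero hπ h1 i]

/-! ### Functions annihilated by the `Q`-matrix -/

/-- Errors add up because P_s is a sup-norm contraction: P_{(n+1)s}f − f = P_s(P_{ns}f − f) + (P_s f
− f). -/
lemma IsTransitionFunction.abs_sub_le {P : ℝ≥0 → Matrix E E ℝ} (hP : IsTransitionFunction P)
    {f : E → ℝ} {s : ℝ≥0} {c : ℝ} (h : ∀ i, |(∑ j, P s i j * f j) - f i| ≤ c) (n : ℕ) (i : E) :
    |(∑ j, P (n * s) i j * f j) - f i| ≤ n * c := by
  induction n generalizing i with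
  | zero => simp [hP.zero, Matrix.one_apply]
  | succ n ih =>
    have h1 : (∑ j, P ((n + 1 : ℕ) * s) i j * f j) - f i =
        (∑ k, P s i k * ((∑ j, P (n * s) k j * f j) - f k)) +
          ((∑ j, P s i j * f j) - f i) := by
      have : ((n + 1 : ℕ) : ℝ≥0) * s = s + n * s := by push_cast; ring
      simp_rw [this, hP.add, Matrix.mul_apply, mul_sub, Finset.sum_sub_distrib, Finset.sum_mul,
        Finset.mul_sum]
      rw [Finset.sum_comm]
      simp_rw [mul_assoc]
      ring
    rw [h1]
    have h2 : |∑ k, P s i k * ((∑ j, P (n * s) k j * f j) - f k)| ≤ n * c := by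
      calc _ ≤ ∑ k, |P s i k * ((∑ j, P (n * s) k j * f j) - f k)| :=
            Finset.abs_sum_le_sum_abs _ _
        _ ≤ ∑ k, P s i k * (n * c) := Finset.sum_le_sum fun k _ => by
            rw [abs_mul, abs_of_nonneg (hP.nonneg s i k)]
            exact mul_le_mul_of_nonneg_left (ih k) (hP.nonneg s i k)
        _ = n * c := by rw [← Finset.sum_mul, hP.row_sum, one_mul]
    push_cast
    linarith [abs_add_le (∑ k, P s i k * ((∑ j, P (n * s) k j * f j) - f k))
      ((∑ j, P s i j * f j) - f i), h i]

lemma tendsto_div_succ_nhdsGT {t : ℝ≥0} (ht : 0 < t) :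
    Tendsto (fun n : ℕ => t / ((n : ℝ≥0) + 1)) atTop (𝓝[>] 0) := by
  refine tendsto_nhdsWithin_iff.2 ⟨?_, Eventually.of_forall fun n => ?_⟩
  · rw [← NNReal.tendsto_coe]
    push_cast
    simpa [div_eq_mul_inv] using
      (tendsto_one_div_add_atTop_nhds_zero_nat (𝕜 := ℝ)).const_mul (t : ℝ)
  · exact div_pos ht (by positivity)

/-- A function annihilated by the `Q`-matrix is invariant under the semigroup. -/
lemma IsTransitionFunction.apply_eq_self {P : ℝ≥0 → Matrix E E ℝ} (hP : IsTransitionFunction P)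
    {Q : Matrix E E ℝ} (hQ : HasQMatrix P Q) {f : E → ℝ} (hf : ∀ i, ∑ j, Q i j * f j = 0)
    {t : ℝ≥0} (ht : 0 < t) (i : E) : ∑ j, P t i j * f j = f i := by
  -- Cut [0, t] into n + 1 equal steps. Since Qf = 0, for large n each step moves f by at most η
  -- times its length.
  have key : ∀ η : ℝ, 0 < η → |(∑ j, P t i j * f j) - f i| ≤ t * η := by
    intro η hη
    have h1 : ∀ᶠ s : ℝ≥0 in 𝓝[>] 0, ∀ i, |((∑ j, P s i j * f j) - f i) / (s : ℝ)| ≤ η := by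
      refine eventually_all.2 fun i => ?_
      have := (hQ.tendsto_quotient f i).abs
      rw [hf, abs_zero] at this
      exact this.eventually (eventually_le_nhds hη)
    obtain ⟨n, hn⟩ := ((tendsto_div_succ_nhdsGT ht).eventually h1).exists
    have hpos : (0 : ℝ) < (t / ((n : ℝ≥0) + 1) : ℝ≥0) :=
      NNReal.coe_pos.2 (div_pos ht (by positivity))
    have h2 := hP.abs_sub_le (f := f) (s := t / ((n : ℝ≥0) + 1))
      (c := (t / ((n : ℝ≥0) + 1) : ℝ≥0) * η) (fun i => by
        have := hn i
        rw [abs_div, abs_of_pos hpos, div_le_iff₀ hpos] at this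
        linarith) (n + 1) i
    have h3 : ((n + 1 : ℕ) : ℝ≥0) * (t / ((n : ℝ≥0) + 1)) = t := by
      push_cast; field_simp
    rw [h3, ← mul_assoc] at h2
    rwa [show ((n + 1 : ℕ) : ℝ) * ((t / ((n : ℝ≥0) + 1) : ℝ≥0) : ℝ) = t by
      exact_mod_cast h3] at h2
  have h0 : |(∑ j, P t i j * f j) - f i| ≤ 0 := by
    refine le_of_forall_pos_le_add fun η hη => ?_
    have ht' : (0 : ℝ) < t := ht
    have := key (η / t) (by positivity)
    rwa [mul_div_cancel₀ _ ht'.ne', ← zero_add η] at this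
  linarith [abs_nonpos_iff.1 h0]

/-- The Dirichlet form of an irreducible chain vanishes only at constants. -/
lemma eq_of_qForm_self_eq_zero {P : ℝ≥0 → Matrix E E ℝ} (hP : IsTransitionFunction P)
    {Q : Matrix E E ℝ} (hQ : HasQMatrix P Q) (hirr : Irreducible P) {π : E → ℝ}
    (hπ : IsInvariantDistribution P π) {f : E → ℝ} (hf : qForm Q π f f = 0) (i j : E) :
    f j = f i := by
  have hpos := hπ.pos hP.nonneg hirr
  have hoff : ∀ i j, i ≠ j → 0 ≤ Q i j := fun i j hij => hQ.nonneg_of_ne hP.nonneg hij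
  have hrow := hQ.row_sum hP.row_sum
  have hterm : ∀ k l, 0 ≤ π k * Q k l * (f k - f l) ^ 2 := fun k l => by
    rcases eq_or_ne k l with rfl | hkl
    · simp
    · exact mul_nonneg (mul_nonneg (hpos k).le (hoff k l hkl)) (sq_nonneg _)
  have h0 := qForm_self hrow (hQ.invariant hπ) f
  rw [hf] at h0
  have hedge : ∀ k l, Q k l = 0 ∨ f k = f l := fun k l => by
    have h1 : ∑ i, ∑ j, π i * Q i j * (f i - f j) ^ 2 = 0 := by linarith
    have h2 := (Finset.sum_eq_zero_iff_of_nonneg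
      (fun k _ => Finset.sum_nonneg fun l _ => hterm k l)).1 h1 k (Finset.mem_univ k)
    have h3 := (Finset.sum_eq_zero_iff_of_nonneg (fun l _ => hterm k l)).1 h2 l
      (Finset.mem_univ l)
    have := (hpos k).ne'
    simpa [this, sub_eq_zero] using h3
  -- As f agrees across every nonzero entry of Q, Q annihilates any function of f. The square (f − f
  -- i)² is chosen because it is nonnegative and vanishes at i: its average under P t i is then 0,
  -- which kills the term at j.
  have hker : ∀ k, ∑ l, Q k l * (f l - f i) ^ 2 = 0 := fun k => by
    have : ∀ l, Q k l * (f l - f i) ^ 2 = Q k l * (f k - f i) ^ 2 := fun l => by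
      rcases hedge k l with h | h <;> rw [h]
      simp
    simp_rw [this]
    rw [← Finset.sum_mul, hrow, zero_mul]
  obtain ⟨t, ht, htp⟩ := hirr i j
  have h1 := hP.apply_eq_self hQ hker ht i
  rw [sub_self, zero_pow two_ne_zero] at h1
  have h2 := (Finset.sum_eq_zero_iff_of_nonneg
    (fun l _ => mul_nonneg (hP.nonneg t i l) (sq_nonneg (f l - f i)))).1 h1 j (Finset.mem_univ j)
  have := htp.ne'
  simpa [this, sub_eq_zero] using h2

/-! ### The spectral gap -/

/-- The continuous Dirichlet form attains its minimum on the compact set of normalised mean-zero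
functions. A zero minimum would be attained at a constant of mean zero, which has norm 0. -/
lemma exists_pos_le_neg_qForm {P : ℝ≥0 → Matrix E E ℝ} (hP : IsTransitionFunction P)
    {Q : Matrix E E ℝ} (hQ : HasQMatrix P Q) (hirr : Irreducible P) {π : E → ℝ}
    (hπ : IsInvariantDistribution P π) :
    ∃ c : ℝ, 0 < c ∧ ∀ f, normL2 π f = 1 → mean π f = 0 → c ≤ -qForm Q π f f := by
  have hpos := hπ.pos hP.nonneg hirr
  have hcont : Continuous fun f : E → ℝ => -qForm Q π f f := by
    unfold qForm innerL2; fun_prop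
  let S : Set (E → ℝ) := {f | innerL2 π f f = 1 ∧ mean π f = 0}
  have hclosed : IsClosed S := by
    refine (isClosed_eq ?_ continuous_const).inter (isClosed_eq ?_ continuous_const)
    · unfold innerL2; fun_prop
    · unfold mean; fun_prop
  have hsub : S ⊆ Set.univ.pi fun i => Set.Icc (-(1 + 1 / π i)) (1 + 1 / π i) := by
    rintro f ⟨hf, -⟩ i -
    have h1 : π i * f i * f i ≤ 1 := hf ▸ Finset.single_le_sum (f := fun i => π i * f i * f i)
      (fun i _ => by rw [mul_assoc]; exact mul_nonneg (hpos i).le (mul_self_nonneg _))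
      (Finset.mem_univ i)
    have h2 : f i ^ 2 ≤ 1 / π i := by
      rw [le_div_iff₀ (hpos i)]; nlinarith
    constructor <;> nlinarith [sq_nonneg (f i + 1), sq_nonneg (f i - 1)]
  have hcompact : IsCompact S :=
    (isCompact_univ_pi fun i => isCompact_Icc).of_isClosed_subset hclosed hsub
  rcases S.eq_empty_or_nonempty with hS | hS
  -- This is the one-point space, where any constant serves.
  · refine ⟨1, one_pos, fun f h1 h2 => ?_⟩
    exact absurd (show f ∈ S from ⟨by simpa [normL2] using h1, h2⟩) (hS ▸ Set.notMem_empty f)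
  · obtain ⟨f, hf, hmin⟩ := hcompact.exists_isMinOn hS hcont.continuousOn
    refine ⟨-qForm Q π f f, ?_, fun h h1 h2 => hmin ⟨by simpa [normL2] using h1, h2⟩⟩
    refine lt_of_le_of_ne (qForm_neg_nonneg hpos (hQ.row_sum hP.row_sum) (hQ.invariant hπ)
      (fun i j hij => hQ.nonneg_of_ne hP.nonneg hij) f) fun h0 => ?_
    have hc := eq_of_qForm_self_eq_zero hP hQ hirr hπ (f := f) (by linarith)
    have hz : ∀ i, f i = 0 := fun i => by
      have h1 := hf.2
      unfold mean at h1
      simp_rw [fun j => hc i j] at h1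
      rwa [← Finset.sum_mul, hπ.sum_eq_one, one_mul] at h1
    have h1 := hf.1
    simp [innerL2, hz] at h1

lemma spectralGap_pos {P : ℝ≥0 → Matrix E E ℝ} (hP : IsTransitionFunction P)
    {Q : Matrix E E ℝ} (hQ : HasQMatrix P Q) (hirr : Irreducible P) {π : E → ℝ}
    (hπ : IsInvariantDistribution P π) : 0 < spectralGap P π := by
  obtain ⟨c, hc, h⟩ := exists_pos_le_neg_qForm hP hQ hirr hπ
  refine lt_of_lt_of_le (EReal.coe_pos.2 hc) (le_sInf ?_)
  rintro _ ⟨f, k, hk, h1, h2, rfl⟩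
  rw [hk.eq hQ (hπ.pos hP.nonneg hirr)]
  exact EReal.coe_le_coe (h f h1 h2)

/-- The Poincaré inequality. -/
lemma poincare {P : ℝ≥0 → Matrix E E ℝ} (hP : IsTransitionFunction P)
    {Q : Matrix E E ℝ} (hQ : HasQMatrix P Q) {π : E → ℝ}
    (hπ : IsInvariantDistribution P π) (hpos : ∀ i, 0 < π i) {l : ℝ}
    (hl : (l : EReal) ≤ spectralGap P π) (f : E → ℝ) :
    l * (innerL2 π f f - mean π f ^ 2) ≤ -qForm Q π f f := by
  rw [← qForm_sub_const (hQ.row_sum hP.row_sum) (hQ.invariant hπ) f (mean π f)]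
  set h : E → ℝ := fun i => f i - mean π f with hh
  have hmean : mean π h = 0 := by
    simp only [mean, hh, mul_sub, Finset.sum_sub_distrib, ← Finset.sum_mul, hπ.sum_eq_one]
    simp
  have hvar : innerL2 π f f - mean π f ^ 2 = innerL2 π h h := by
    have : innerL2 π h h = innerL2 π f f - 2 * mean π f * ∑ i, π i * f i
        + mean π f ^ 2 * ∑ i, π i := by
      simp only [innerL2, hh, Finset.mul_sum, ← Finset.sum_add_distrib,
        ← Finset.sum_sub_distrib]
      exact Finset.sum_congr rfl fun i _ => by ring
    rw [this, hπ.sum_eq_one, show ∑ i, π i * f i = mean π f from rfl]; ring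
  rw [hvar]
  -- A function of zero variance cannot be normalised, but then both sides vanish.
  rcases (innerL2_self_nonneg (fun i => (hpos i).le) h).eq_or_lt with h0 | h0
  · have hz := innerL2_self_eq_zero hpos h0.symm
    simp [qForm, innerL2, hz]
  · set r := √(innerL2 π h h) with hr
    have hrpos : 0 < r := Real.sqrt_pos.2 h0
    have hr2 : r ^ 2 = innerL2 π h h := Real.sq_sqrt h0.le
    have h1 : innerL2 π (fun i => r⁻¹ * h i) (fun i => r⁻¹ * h i) = 1 := by
      have : innerL2 π (fun i => r⁻¹ * h i) (fun i => r⁻¹ * h i) = (r ^ 2)⁻¹ * innerL2 π h h := by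
        simp only [innerL2, Finset.mul_sum]
        exact Finset.sum_congr rfl fun i _ => by ring
      rw [this, hr2, inv_mul_cancel₀ h0.ne']
    have h2 : mean π (fun i => r⁻¹ * h i) = 0 := by
      have : mean π (fun i => r⁻¹ * h i) = r⁻¹ * mean π h := by
        simp only [mean, Finset.mul_sum]
        exact Finset.sum_congr rfl fun i _ => by ring
      rw [this, hmean, mul_zero]
    have h3 : qForm Q π (fun i => r⁻¹ * h i) (fun i => r⁻¹ * h i) = (r ^ 2)⁻¹ * qForm Q π h h := by
      simp only [qForm, innerL2, Finset.mul_sum, Finset.sum_mul]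
      exact Finset.sum_congr rfl fun i _ => Finset.sum_congr rfl fun j _ => by ring
    have h4 : l ≤ -((r ^ 2)⁻¹ * qForm Q π h h) := by
      rw [← h3]
      exact EReal.coe_le_coe_iff.1 (hl.trans (sInf_le
        ⟨_, _, hQ.isGeneratorAt π _, by rw [normL2, h1, Real.sqrt_one], h2, rfl⟩))
    rw [← hr2]
    have h5 := mul_le_mul_of_nonneg_right h4 (sq_nonneg r)
    have h6 : r ^ 2 ≠ 0 := (pow_pos hrpos 2).ne'
    calc l * r ^ 2 ≤ _ := h5
      _ = -qForm Q π h h := by field_simp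

end CTMC

namespace CTMC

open Filter MeasureTheory
variable {E : Type*} [Fintype E]

/-! ### The tilted generator -/

/-- Replacing `π` by the density `f²` changes the mean of a function with values in `[a, b]`
by at most `(b - a)` times the standard deviation of `f`. -/
lemma sq_innerL2_mul_sub_le {π : E → ℝ} (hnn : ∀ i, 0 ≤ π i) (hsum : ∑ i, π i = 1) {a b : ℝ}
    {g : E → ℝ} (hg : ∀ i, g i ∈ Set.Icc a b) (f : E → ℝ) :
    innerL2 π (fun i => (g i - mean π g) * f i) f ^ 2 ≤
      (b - a) ^ 2 * (innerL2 π f f * (innerL2 π f f - mean π f ^ 2)) := by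
  set r := √(innerL2 π f f) with hr
  have hr2 : r ^ 2 = innerL2 π f f := Real.sq_sqrt (innerL2_self_nonneg hnn f)
  -- Since g − π(g) has mean zero, f² may be replaced by f² − r²; since that has mean zero too, g
  -- may be recentred at the midpoint of [a, b], where its deviation is at most (b − a)/2.
  have e1 : innerL2 π (fun i => (g i - mean π g) * f i) f =
      ∑ i, π i * (g i - (a + b) / 2) * ((f i - r) * (f i + r)) := by
    have h1 : ∑ i, π i * (g i - (a + b) / 2) * ((f i - r) * (f i + r)) =
        (innerL2 π (fun i => (g i - mean π g) * f i) f
          + (mean π g - (a + b) / 2) * innerL2 π f f)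
        - r ^ 2 * (mean π g - (a + b) / 2 * ∑ i, π i) := by
      unfold innerL2
      rw [show mean π g - (a + b) / 2 * ∑ i, π i = ∑ i, π i * (g i - (a + b) / 2) by
        simp only [mean, Finset.mul_sum, ← Finset.sum_sub_distrib]
        exact Finset.sum_congr rfl fun i _ => by ring]
      simp only [Finset.mul_sum, ← Finset.sum_add_distrib, ← Finset.sum_sub_distrib]
      exact Finset.sum_congr rfl fun i _ => by ring
    rw [h1, hsum, hr2]; ring
  have e2 : ∀ c : ℝ, ∑ i, π i * (f i + c) ^ 2 = innerL2 π f f + 2 * c * mean π f + c ^ 2 := by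
    intro c
    have : ∑ i, π i * (f i + c) ^ 2 =
        innerL2 π f f + 2 * c * mean π f + c ^ 2 * ∑ i, π i := by
      simp only [innerL2, mean, Finset.mul_sum, ← Finset.sum_add_distrib]
      exact Finset.sum_congr rfl fun i _ => by ring
    rw [this, hsum, mul_one]
  rw [e1]
  -- Cauchy–Schwarz on the factors f − r and f + r. The product of their squared norms is 4r²(r² −
  -- π(f)²), and the 4 absorbs the square of 1/2.
  calc _ ≤ (∑ i, π i * ((g i - (a + b) / 2) ^ 2 * (f i + -r) ^ 2)) *
        ∑ i, π i * (f i + r) ^ 2 :=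
      Finset.sum_sq_le_sum_mul_sum_of_sq_le_mul _
        (fun i _ => mul_nonneg (hnn i) (by positivity))
        (fun i _ => mul_nonneg (hnn i) (by positivity)) (fun i _ => le_of_eq (by ring))
    _ ≤ (∑ i, ((b - a) / 2) ^ 2 * (π i * (f i + -r) ^ 2)) * ∑ i, π i * (f i + r) ^ 2 := by
      refine mul_le_mul_of_nonneg_right (Finset.sum_le_sum fun i _ => ?_)
        (Finset.sum_nonneg fun i _ => mul_nonneg (hnn i) (sq_nonneg _))
      have h1 : (g i - (a + b) / 2) ^ 2 ≤ ((b - a) / 2) ^ 2 :=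
        sq_le_sq' (by linarith [(hg i).1]) (by linarith [(hg i).2])
      calc _ = (g i - (a + b) / 2) ^ 2 * (π i * (f i + -r) ^ 2) := by ring
        _ ≤ _ := mul_le_mul_of_nonneg_right h1 (mul_nonneg (hnn i) (sq_nonneg _))
    _ = _ := by
      rw [← Finset.mul_sum, e2, e2, neg_sq, hr2]
      have : (innerL2 π f f + 2 * -r * mean π f + innerL2 π f f) *
          (innerL2 π f f + 2 * r * mean π f + innerL2 π f f) =
          4 * (innerL2 π f f) ^ 2 - 4 * r ^ 2 * mean π f ^ 2 := by ring
      rw [mul_assoc, this, hr2]; ring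

lemma mean_sq_le {π : E → ℝ} (hnn : ∀ i, 0 ≤ π i) (hsum : ∑ i, π i = 1) (f : E → ℝ) :
    mean π f ^ 2 ≤ innerL2 π f f := by
  have := Finset.sum_sq_le_sum_mul_sum_of_sq_le_mul (s := Finset.univ) (r := fun i => π i * f i)
    (f := π) (g := fun i => π i * f i * f i) (fun i _ => hnn i)
    (fun i _ => by rw [mul_assoc]; exact mul_nonneg (hnn i) (mul_self_nonneg _))
    (fun i _ => le_of_eq (by ring))
  rwa [hsum, one_mul] at this

/-- Entrywise convergence of matrices gives uniform upper bounds of the quadratic forms. -/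
lemma eventually_quadratic_le {ι : Type*} {F : Filter ι} {N : ι → Matrix E E ℝ}
    {N₀ : Matrix E E ℝ} (hN : ∀ i j, Tendsto (fun s => N s i j) F (𝓝 (N₀ i j))) {π : E → ℝ}
    (hpos : ∀ i, 0 < π i) {η : ℝ} (hη : 0 < η) :
    ∀ᶠ s in F, ∀ f : E → ℝ, ∑ i, ∑ j, N s i j * (f i * f j) ≤
      (∑ i, ∑ j, N₀ i j * (f i * f j)) + η * innerL2 π f f := by
  set c : ℝ := ∑ i, (π i)⁻¹ with hc
  have hc0 : 0 ≤ c := Finset.sum_nonneg fun i _ => (inv_pos.2 (hpos i)).le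
  -- The constant c compares the squared ℓ¹ norm with the squared L²(π) norm; c + 1 keeps the
  -- divisor positive.
  have h1 : ∀ᶠ s in F, ∀ i j, |N s i j - N₀ i j| ≤ η / (c + 1) := by
    refine eventually_all.2 fun i => eventually_all.2 fun j => ?_
    have := ((hN i j).sub_const (N₀ i j)).abs
    rw [sub_self, abs_zero] at this
    exact this.eventually (eventually_le_nhds (by positivity))
  filter_upwards [h1] with s hs f
  have h2 : (∑ i, |f i|) ^ 2 ≤ c * innerL2 π f f :=
    Finset.sum_sq_le_sum_mul_sum_of_sq_le_mul _ (fun i _ => (inv_pos.2 (hpos i)).le)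
      (fun i _ => by rw [mul_assoc]; exact mul_nonneg (hpos i).le (mul_self_nonneg _))
      (fun i _ => le_of_eq (by have := (hpos i).ne'; rw [sq_abs]; field_simp))
  have h3 : (∑ i, ∑ j, N s i j * (f i * f j)) - (∑ i, ∑ j, N₀ i j * (f i * f j)) ≤
      η / (c + 1) * (∑ i, |f i|) ^ 2 := by
    rw [sq, Finset.sum_mul_sum, Finset.mul_sum, ← Finset.sum_sub_distrib]
    refine Finset.sum_le_sum fun i _ => ?_
    rw [Finset.mul_sum, ← Finset.sum_sub_distrib]
    refine Finset.sum_le_sum fun j _ => ?_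
    rw [← sub_mul, ← abs_mul]
    refine (le_abs_self _).trans ?_
    rw [abs_mul]
    exact mul_le_mul_of_nonneg_right (hs i j) (abs_nonneg _)
  have hS := innerL2_self_nonneg (fun i => (hpos i).le) f
  have h4 : η / (c + 1) * (∑ i, |f i|) ^ 2 ≤ η * innerL2 π f f := by
    calc _ ≤ η / (c + 1) * ((c + 1) * innerL2 π f f) :=
          mul_le_mul_of_nonneg_left (h2.trans (by nlinarith)) (by positivity)
      _ = _ := by field_simp
  linarith

/-- The operator `f ↦ P s (w f)`. -/
def weightedStep (P : ℝ≥0 → Matrix E E ℝ) (s : ℝ≥0) (w : E → ℝ) (f : E → ℝ) : E → ℝ :=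
  fun i => ∑ j, P s i j * (w j * f j)

/-- The one-step bound on squared norms is iterated from the function 1, of norm 1; Cauchy–Schwarz
then bounds the mean by the norm. -/
lemma mean_iterate_weightedStep_le {P : ℝ≥0 → Matrix E E ℝ} {π : E → ℝ}
    (hnn : ∀ i, 0 ≤ π i) (hsum : ∑ i, π i = 1) {s : ℝ≥0} {w : E → ℝ} {c : ℝ}
    (h : ∀ f, innerL2 π (weightedStep P s w f) (weightedStep P s w f) ≤
      Real.exp (2 * c) * innerL2 π f f) (n : ℕ) :
    mean π ((weightedStep P s w)^[n] 1) ≤ Real.exp (n * c) := by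
  have h1 : innerL2 π ((weightedStep P s w)^[n] 1) ((weightedStep P s w)^[n] 1) ≤
      Real.exp (n * c) ^ 2 := by
    induction n with
    | zero => simp [innerL2, hsum]
    | succ n ih =>
      rw [Function.iterate_succ_apply']
      refine (h _).trans ((mul_le_mul_of_nonneg_left ih (Real.exp_pos _).le).trans_eq ?_)
      rw [← Real.exp_nat_mul, ← Real.exp_nat_mul, ← Real.exp_add]
      push_cast
      ring_nf
  exact le_of_abs_le (abs_le_of_sq_le_sq ((mean_sq_le hnn hsum _).trans h1) (Real.exp_pos _).le)

variable [DecidableEq E]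

/-- With V the variance of f and K the right-hand side, the squared perturbation is at most 4(lV)K ≤
(lV + K)², and the Poincaré inequality pays for lV. -/
lemma qForm_add_mul_le {P : ℝ≥0 → Matrix E E ℝ} (hP : IsTransitionFunction P)
    {Q : Matrix E E ℝ} (hQ : HasQMatrix P Q) {π : E → ℝ}
    (hπ : IsInvariantDistribution P π) (hpos : ∀ i, 0 < π i) {l : ℝ} (hl0 : 0 < l)
    (hl : (l : EReal) ≤ spectralGap P π) {a b : ℝ} {g : E → ℝ} (hg : ∀ i, g i ∈ Set.Icc a b)
    (θ : ℝ) (f : E → ℝ) :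
    qForm Q π f f + θ * innerL2 π (fun i => (g i - mean π g) * f i) f ≤
      θ ^ 2 * (b - a) ^ 2 / (4 * l) * innerL2 π f f := by
  have h1 := poincare hP hQ hπ hpos hl f
  have h2 := sq_innerL2_mul_sub_le hπ.nonneg hπ.sum_eq_one hg f
  have h3 := mean_sq_le hπ.nonneg hπ.sum_eq_one f
  have hS := innerL2_self_nonneg hπ.nonneg f
  set S := innerL2 π f f
  set V := S - mean π f ^ 2 with hV
  set A := innerL2 π (fun i => (g i - mean π g) * f i) f
  have hV0 : 0 ≤ V := by linarith
  set K := θ ^ 2 * (b - a) ^ 2 / (4 * l) * S with hK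
  have hK0 : 0 ≤ K := by positivity
  have h4 : (θ * A) ^ 2 ≤ (l * V + K) ^ 2 := by
    have e : θ ^ 2 * ((b - a) ^ 2 * (S * V)) = 4 * (l * V) * K := by rw [hK]; field_simp
    calc (θ * A) ^ 2 = θ ^ 2 * A ^ 2 := by ring
      _ ≤ θ ^ 2 * ((b - a) ^ 2 * (S * V)) := mul_le_mul_of_nonneg_left h2 (sq_nonneg _)
      _ = 4 * (l * V) * K := e
      _ ≤ (l * V + K) ^ 2 := by linarith [sq_nonneg (l * V - K)]
  have h5 : θ * A ≤ l * V + K := le_of_abs_le (abs_le_of_sq_le_sq h4 (by positivity))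
  linarith

/-- The growth rate of the exponentially weighted semigroup over a short time is controlled by
the quadratic form of the tilted generator. -/
lemma eventually_weightedStep_le {P : ℝ≥0 → Matrix E E ℝ}
    {Q : Matrix E E ℝ} (hQ : HasQMatrix P Q) {π : E → ℝ} (hpos : ∀ i, 0 < π i)
    {v : E → ℝ} {L L' : ℝ} (hL : L < L')
    (hv : ∀ f, qForm Q π f f + innerL2 π (fun i => v i * f i) f ≤ L * innerL2 π f f) :
    ∀ᶠ s : ℝ≥0 in 𝓝[>] 0, ∀ f : E → ℝ,
      innerL2 π (weightedStep P s (fun i => Real.exp (s * v i)) f)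
        (weightedStep P s (fun i => Real.exp (s * v i)) f) ≤
        Real.exp (2 * L' * s) * innerL2 π f f := by
  set M : ℝ≥0 → Matrix E E ℝ := fun s => Matrix.of fun i j => P s i j * Real.exp (s * v j) with hM
  set B : Matrix E E ℝ := fun i j => Q i j + (1 : Matrix E E ℝ) i j * v j with hB
  have hcoe : Tendsto (fun s : ℝ≥0 => (s : ℝ)) (𝓝[>] 0) (𝓝[>] 0) := by
    refine tendsto_nhdsWithin_iff.2 ⟨?_, ?_⟩
    · exact (NNReal.continuous_coe.tendsto' 0 0 rfl).mono_left nhdsWithin_le_nhds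
    · exact eventually_mem_nhdsWithin.mono fun s hs => NNReal.coe_pos.2 hs
  have hcoe0 : Tendsto (fun s : ℝ≥0 => (s : ℝ)) (𝓝[>] 0) (𝓝 0) :=
    hcoe.mono_right nhdsWithin_le_nhds
  have hexp : ∀ j, Tendsto (fun s : ℝ≥0 => Real.exp (s * v j)) (𝓝[>] 0) (𝓝 1) := fun j => by
    have : Tendsto (fun s : ℝ≥0 => Real.exp (s * v j)) (𝓝[>] 0) (𝓝 (Real.exp (0 * v j))) :=
      (Real.continuous_exp.tendsto _).comp (hcoe0.mul_const _)
    simpa using this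
  have hexp' : ∀ j, Tendsto (fun s : ℝ≥0 => (Real.exp (s * v j) - 1) / (s : ℝ)) (𝓝[>] 0)
      (𝓝 (v j)) := fun j => by
    have h1 : HasDerivAt (fun x : ℝ => Real.exp (x * v j)) (v j) 0 := by
      have := ((hasDerivAt_id (0 : ℝ)).mul_const (v j)).exp
      simpa using this
    have h2 := h1.hasDerivWithinAt (s := Set.Ioi 0)
    rw [hasDerivWithinAt_iff_tendsto_slope' (by simp)] at h2
    refine (h2.comp hcoe).congr fun s => ?_
    simp [slope_def_field]
  -- The step operator is I + sC, and C tends to the tilted generator B = Q + diag(v).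
  set C : ℝ≥0 → Matrix E E ℝ := fun s => Matrix.of fun i j =>
    (M s i j - (1 : Matrix E E ℝ) i j) / (s : ℝ) with hC
  have hClim : ∀ i j, Tendsto (fun s => C s i j) (𝓝[>] 0) (𝓝 (B i j)) := fun i j => by
    have h1 := ((hQ i j).mul (hexp j)).add ((hexp' j).const_mul ((1 : Matrix E E ℝ) i j))
    rw [mul_one] at h1
    refine h1.congr fun s => ?_
    simp only [hC, hM, Matrix.of_apply]
    ring
  -- N is defined so that ‖f + sCf‖² = ‖f‖² + s ∑ N f f. Its limit is the symmetrised B, with form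
  -- at most 2L‖f‖²; the slack 2(L' − L) makes the bound uniform in f.
  set N : ℝ≥0 → Matrix E E ℝ := fun s => Matrix.of fun i j =>
    π i * C s i j + π j * C s j i + s * ∑ k, π k * C s k i * C s k j with hN
  have hNlim : ∀ i j, Tendsto (fun s => N s i j) (𝓝[>] 0) (𝓝 (π i * B i j + π j * B j i)) :=
    fun i j => by
    have h1 := (((hClim i j).const_mul (π i)).add ((hClim j i).const_mul (π j))).add
      (hcoe0.mul (tendsto_finsetSum Finset.univ fun k _ =>
        ((hClim k i).const_mul (π k)).mul (hClim k j)))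
    rwa [zero_mul, add_zero] at h1
  have hquad := eventually_quadratic_le (N₀ := fun i j => π i * B i j + π j * B j i) hNlim hpos
    (show 0 < 2 * (L' - L) by linarith)
  filter_upwards [hquad, eventually_mem_nhdsWithin] with s hs hs0 f
  have hs0' : (0 : ℝ) < s := NNReal.coe_pos.2 hs0
  have e1 : ∀ i, weightedStep P s (fun i => Real.exp (s * v i)) f i =
      f i + s * ∑ j, C s i j * f j := fun i => by
    simp only [hC, hM, Matrix.of_apply, weightedStep, Finset.mul_sum]
    have : ∀ j, (s : ℝ) * ((P s i j * Real.exp (s * v j) - (1 : Matrix E E ℝ) i j) / s * f j) =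
        P s i j * (Real.exp (s * v j) * f j) - (1 : Matrix E E ℝ) i j * f j := fun j => by
      field_simp
    simp_rw [this, Finset.sum_sub_distrib]
    simp [Matrix.one_apply]
  have e2 : ∑ i, ∑ j, N s i j * (f i * f j) = 2 * (∑ i, π i * (∑ j, C s i j * f j) * f i)
      + s * ∑ k, π k * (∑ j, C s k j * f j) * (∑ j, C s k j * f j) := by
    have a1 : ∑ i, ∑ j, π i * C s i j * (f i * f j) = ∑ i, π i * (∑ j, C s i j * f j) * f i :=
      Finset.sum_congr rfl fun i _ => by
        rw [Finset.mul_sum, Finset.sum_mul]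
        exact Finset.sum_congr rfl fun j _ => by ring
    have a2 : ∑ i, ∑ j, π j * C s j i * (f i * f j) = ∑ i, π i * (∑ j, C s i j * f j) * f i := by
      rw [Finset.sum_comm, ← a1]
      exact Finset.sum_congr rfl fun i _ => Finset.sum_congr rfl fun j _ => by ring
    have a3 : ∑ i, ∑ j, (∑ k, π k * C s k i * C s k j) * (f i * f j) =
        ∑ k, π k * (∑ j, C s k j * f j) * (∑ j, C s k j * f j) := by
      simp_rw [Finset.sum_mul]
      rw [Finset.sum_congr rfl fun i _ => Finset.sum_comm, Finset.sum_comm]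
      refine Finset.sum_congr rfl fun k _ => ?_
      rw [mul_assoc, Finset.sum_mul_sum, Finset.mul_sum]
      refine Finset.sum_congr rfl fun i _ => ?_
      rw [Finset.mul_sum]
      exact Finset.sum_congr rfl fun j _ => by ring
    simp only [hN, Matrix.of_apply, add_mul, Finset.sum_add_distrib]
    have a4 : ∑ i, ∑ j, (s : ℝ) * (∑ k, π k * C s k i * C s k j) * (f i * f j) =
        s * ∑ i, ∑ j, (∑ k, π k * C s k i * C s k j) * (f i * f j) := by
      rw [Finset.mul_sum]
      refine Finset.sum_congr rfl fun i _ => ?_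
      rw [Finset.mul_sum]
      exact Finset.sum_congr rfl fun j _ => by rw [mul_assoc]
    rw [a1, a2, a4, a3]; ring
  have e3 : ∑ i, ∑ j, (π i * B i j + π j * B j i) * (f i * f j) =
      2 * (qForm Q π f f + innerL2 π (fun i => v i * f i) f) := by
    have a1 : ∑ i, ∑ j, π i * B i j * (f i * f j) =
        qForm Q π f f + innerL2 π (fun i => v i * f i) f := by
      simp only [qForm, innerL2, ← Finset.sum_add_distrib]
      refine Finset.sum_congr rfl fun i _ => ?_
      have : ∑ j, B i j * f j = (∑ j, Q i j * f j) + v i * f i := by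
        simp only [hB, add_mul, Finset.sum_add_distrib]
        simp [Matrix.one_apply]
      rw [← add_mul, ← mul_add, ← this, Finset.mul_sum, Finset.sum_mul]
      exact Finset.sum_congr rfl fun j _ => by ring
    have a2 : ∑ i, ∑ j, π j * B j i * (f i * f j) = ∑ i, ∑ j, π i * B i j * (f i * f j) := by
      rw [Finset.sum_comm]
      exact Finset.sum_congr rfl fun i _ => Finset.sum_congr rfl fun j _ => by ring
    simp only [add_mul, Finset.sum_add_distrib]
    rw [a2, a1]; ring
  have e4 : innerL2 π (weightedStep P s (fun i => Real.exp (s * v i)) f)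
      (weightedStep P s (fun i => Real.exp (s * v i)) f) =
      innerL2 π f f + s * ∑ i, ∑ j, N s i j * (f i * f j) := by
    rw [e2]
    simp only [innerL2, e1]
    generalize (fun i => ∑ j, C s i j * f j) = u
    rw [mul_add, ← mul_assoc, ← mul_assoc]
    simp only [Finset.mul_sum (a := (s : ℝ) * 2), Finset.mul_sum (a := (s : ℝ) * s),
      ← Finset.sum_add_distrib]
    exact Finset.sum_congr rfl fun i _ => by ring
  have hf := hs f
  rw [e3] at hf
  have h5 : ∑ i, ∑ j, N s i j * (f i * f j) ≤ 2 * L' * innerL2 π f f := by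
    linarith [hv f]
  rw [e4]
  have hS := innerL2_self_nonneg (fun i => (hpos i).le) f
  calc _ ≤ innerL2 π f f + s * (2 * L' * innerL2 π f f) := by gcongr
    _ = (2 * L' * s + 1) * innerL2 π f f := by ring
    _ ≤ _ := mul_le_mul_of_nonneg_right (Real.add_one_le_exp _) hS

end CTMC

namespace CTMC

open Filter MeasureTheory

/-! ### Riemann sums of right-continuous functions -/

/-- Right-endpoint Riemann sums of a bounded right-continuous function converge to its integral. -/
lemma tendsto_riemannSum {u : ℝ → ℝ} {c t : ℝ} (ht : 0 < t) (hbd : ∀ s, |u s| ≤ c)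
    (hu : ∀ s, 0 ≤ s → Tendsto u (𝓝[>] s) (𝓝 (u s))) :
    Tendsto (fun n : ℕ => ∑ k ∈ Finset.range (n + 1),
      t / ((n : ℝ) + 1) * u ((k + 1) * (t / ((n : ℝ) + 1)))) atTop
      (𝓝 (∫ s in (0 : ℝ)..t, u s)) := by
  set d : ℕ → ℝ := fun n => t / ((n : ℝ) + 1) with hd
  have hdpos : ∀ n, 0 < d n := fun n => by positivity
  -- The sampling point (⌊s/d⌋ + 1)d lies strictly to the right of s, even when s is a grid point,
  -- so right-continuity alone gives pointwise convergence.
  set F : ℕ → ℝ → ℝ := fun n s => u ((⌊s / d n⌋₊ + 1) * d n) with hF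
  have hmeas : ∀ n, Measurable (F n) := fun n =>
    (measurable_from_top (f := fun k : ℕ => u ((k + 1) * d n))).comp
      (Nat.measurable_floor.comp (measurable_id.div_const _))
  have hint : ∀ n x y, IntervalIntegrable (F n) volume x y := fun n x y =>
    (intervalIntegrable_const (c := c)).mono_fun (hmeas n).aestronglyMeasurable
      (Eventually.of_forall fun s => by
        simpa using (hbd _).trans (le_abs_self c))
  have hsum : ∀ n : ℕ, ∫ s in (0 : ℝ)..t, F n s =
      ∑ k ∈ Finset.range (n + 1), d n * u ((k + 1) * d n) := by
    intro n
    have h1 := intervalIntegral.sum_integral_adjacent_intervals (f := F n) (μ := volume)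
      (a := fun k : ℕ => k * d n) (n := n + 1) (fun k _ => hint n _ _)
    have h2 : ((n + 1 : ℕ) : ℝ) * d n = t := by
      simp only [hd]; push_cast; field_simp
    simp only [h2, Nat.cast_zero, zero_mul] at h1
    rw [← h1]
    refine Finset.sum_congr rfl fun k _ => ?_
    have hle : (k : ℝ) * d n ≤ ((k + 1 : ℕ) : ℝ) * d n := by
      push_cast; nlinarith [hdpos n]
    have h3 : ∫ s in (k * d n : ℝ)..((k + 1 : ℕ) * d n), F n s =
        ∫ s in (k * d n : ℝ)..((k + 1 : ℕ) * d n), u ((k + 1) * d n) := by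
      -- The floor jumps at the right endpoint, a null set, which is discarded.
      rw [intervalIntegral.integral_of_le hle, intervalIntegral.integral_of_le hle,
        integral_Ioc_eq_integral_Ioo, integral_Ioc_eq_integral_Ioo]
      refine setIntegral_congr_fun measurableSet_Ioo fun s hs => ?_
      have hs0 : 0 ≤ s / d n := by
        have := hdpos n
        have := hs.1
        exact div_nonneg (le_trans (by positivity) hs.1.le) (hdpos n).le
      have : ⌊s / d n⌋₊ = k := by
        rw [Nat.floor_eq_iff hs0, le_div_iff₀ (hdpos n), div_lt_iff₀ (hdpos n)]
        exact ⟨hs.1.le, by simpa using hs.2⟩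
      simp only [hF, this]
    rw [h3, intervalIntegral.integral_const, smul_eq_mul]
    push_cast
    ring
  refine Tendsto.congr hsum ?_
  refine intervalIntegral.tendsto_integral_filter_of_dominated_convergence (fun _ => c)
    (Eventually.of_forall fun n => (hmeas n).aestronglyMeasurable)
    (Eventually.of_forall fun n => Eventually.of_forall fun s _ => hbd _)
    intervalIntegrable_const (Eventually.of_forall fun s hs => ?_)
  rw [Set.uIoc_of_le ht.le] at hs
  refine (hu s hs.1.le).comp (tendsto_nhdsWithin_iff.2 ⟨?_, Eventually.of_forall fun n => ?_⟩)
  · have hd0 : Tendsto d atTop (𝓝 0) := by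
      simpa [hd, div_eq_mul_inv] using
        (tendsto_one_div_add_atTop_nhds_zero_nat (𝕜 := ℝ)).const_mul t
    refine tendsto_of_tendsto_of_tendsto_of_le_of_le (g := fun _ => s)
      (h := fun n => s + d n) tendsto_const_nhds (by simpa using hd0.const_add s)
      (fun n => ?_) fun n => ?_
    · have := Nat.lt_floor_add_one (s / d n)
      rw [div_lt_iff₀ (hdpos n)] at this
      exact this.le
    · have := Nat.floor_le (div_nonneg hs.1.le (hdpos n).le)
      rw [le_div_iff₀ (hdpos n)] at this
      show (_ + 1) * d n ≤ s + d n
      linarith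
  · have := Nat.lt_floor_add_one (s / d n)
    rwa [div_lt_iff₀ (hdpos n)] at this

/-! ### Functionals of the chain at finitely many times -/

lemma integral_comp_eq_sum {Ω α : Type*} [MeasurableSpace Ω] {μ : Measure Ω}
    [IsFiniteMeasure μ] [Fintype α] {W : Ω → α}
    (hW : ∀ x, MeasurableSet {ω | W ω = x}) (F : α → ℝ) :
    ∫ ω, F (W ω) ∂μ = ∑ x, μ.real {ω | W ω = x} * F x := by
  let _ : MeasurableSpace α := ⊤
  have hWm : Measurable W := measurable_to_countable' hW
  rw [← integral_map (f := F) hWm.aemeasurable (measurable_from_top.aestronglyMeasurable),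
    integral_fintype (Integrable.of_finite)]
  refine Finset.sum_congr rfl fun x _ => ?_
  rw [smul_eq_mul, map_measureReal_apply hWm (measurableSet_singleton x)]
  rfl

lemma IsMarkovChain.measurableSet_history {E Ω : Type*} [MeasurableSpace Ω] {μ : Measure Ω}
    {X : ℝ≥0 → Ω → E} {P : ℝ≥0 → Matrix E E ℝ} {ν : E → ℝ} (hX : IsMarkovChain μ X P ν) {n : ℕ}
    (t : Fin n → ℝ≥0) (y : Fin n → E) : MeasurableSet {ω | ∀ k, X (t k) ω = y k} := by
  rw [Set.ofPred_forall]
  exact MeasurableSet.iInter fun k => hX.measurable _ _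

variable {E Ω : Type*} [Fintype E] [MeasurableSpace Ω] {μ : Measure Ω}
  {X : ℝ≥0 → Ω → E} {P : ℝ≥0 → Matrix E E ℝ} {ν : E → ℝ}

/-- The Markov property for a function of finitely many past values. -/
lemma IsMarkovChain.integral_mul [IsFiniteMeasure μ] (hX : IsMarkovChain μ X P ν)
    {n : ℕ} {t : Fin (n + 1) → ℝ≥0} (ht : Monotone t) (s : ℝ≥0) (H : (Fin (n + 1) → E) → ℝ)
    (F : E → ℝ) :
    ∫ ω, H (fun k => X (t k) ω) * F (X (t (Fin.last n) + s) ω) ∂μ =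
      ∫ ω, H (fun k => X (t k) ω) * ∑ j, P s (X (t (Fin.last n)) ω) j * F j ∂μ := by
  have hY : ∀ y : Fin (n + 1) → E, {ω | (fun k => X (t k) ω) = y} = {ω | ∀ k, X (t k) ω = y k} :=
    fun y => by ext ω; exact funext_iff
  have hpair : ∀ p : (Fin (n + 1) → E) × E,
      {ω | ((fun k => X (t k) ω), X (t (Fin.last n) + s) ω) = p} =
        {ω | (∀ k, X (t k) ω = p.1 k) ∧ X (t (Fin.last n) + s) ω = p.2} := fun p => by
    ext ω
    simp [Prod.ext_iff, funext_iff]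
  rw [integral_comp_eq_sum (W := fun ω => ((fun k => X (t k) ω), X (t (Fin.last n) + s) ω))
      (fun p => by
        rw [hpair]
        exact (hX.measurableSet_history t p.1).inter (hX.measurable _ _))
      (fun p => H p.1 * F p.2),
    integral_comp_eq_sum (W := fun ω => (fun k => X (t k) ω))
      (fun y => by rw [hY]; exact hX.measurableSet_history t y)
      (fun y => H y * ∑ j, P s (y (Fin.last n)) j * F j), Fintype.sum_prod_type]
  refine Finset.sum_congr rfl fun y _ => ?_
  simp_rw [hpair, hY, hX.markov n t y s _ ht]
  rw [Finset.mul_sum, Finset.mul_sum]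
  exact Finset.sum_congr rfl fun j _ => by ring

/-- Weighted path expectations are iterates of the weighted transition operator. -/
lemma IsMarkovChain.integral_prod [DecidableEq E] [IsFiniteMeasure μ] (hX : IsMarkovChain μ X P ν)
    (d : ℝ≥0) (w : E → ℝ) (n : ℕ) (F : E → ℝ) :
    ∫ ω, (∏ k ∈ Finset.range n, w (X ((k + 1) * d) ω)) * F (X (n * d) ω) ∂μ =
      mean ν ((weightedStep P d w)^[n] F) := by
  induction n generalizing F with
  | zero =>
    simp only [Finset.range_zero, Finset.prod_empty, one_mul, Nat.cast_zero, zero_mul,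
      Function.iterate_zero, id]
    rw [integral_comp_eq_sum (hX.measurable 0)]
    simp_rw [hX.initial]
    rfl
  | succ n ih =>
    rw [Function.iterate_succ_apply, ← ih]
    -- Conditioning on the times 0, d, …, nd replaces the last factor w·F by P_d(w·F). The successor
    -- index skips time 0, which carries no weight.
    have h := hX.integral_mul (t := fun k : Fin (n + 1) => (k : ℕ) * d)
      (fun i j hij => mul_le_mul_left (Nat.cast_le.2 hij) d) d
      (fun y => ∏ k : Fin n, w (y k.succ)) (fun j => w j * F j)
    simp only [Fin.val_succ, Fin.val_last] at h
    convert h using 3 with ω ω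
    · rw [Finset.prod_range_succ, mul_assoc, ← Fin.prod_univ_eq_prod_range
        (fun k => w (X ((k + 1) * d) ω))]
      push_cast
      rw [add_one_mul]
    · rw [← Fin.prod_univ_eq_prod_range (fun k => w (X ((k + 1) * d) ω))]
      push_cast
      rfl

end CTMC

namespace CTMC

open Filter MeasureTheory

variable {E Ω : Type*} [Fintype E] [MeasurableSpace Ω] {μ : Measure Ω}
  {X : ℝ≥0 → Ω → E} {P : ℝ≥0 → Matrix E E ℝ} {π : E → ℝ}

/-! ### The concentration inequality -/

lemma IsMarkovChain.integrable_prod [IsFiniteMeasure μ] (hX : IsMarkovChain μ X P π)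
    (d : ℝ≥0) (w : E → ℝ) (n : ℕ) :
    Integrable (fun ω => ∏ k ∈ Finset.range n, w (X ((k + 1) * d) ω)) μ := by
  let _ : MeasurableSpace E := ⊤
  have hm : Measurable fun ω => fun k : Fin n => X (((k : ℕ) + 1) * d) ω :=
    measurable_pi_lambda _ fun k => measurable_to_countable' (hX.measurable _)
  have h := (Integrable.of_finite (μ := μ.map fun ω => fun k : Fin n => X (((k : ℕ) + 1) * d) ω)
    (f := fun y : Fin n → E => ∏ k, w (y k))).comp_measurable hm
  refine h.congr (Eventually.of_forall fun ω => ?_)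
  exact Fin.prod_univ_eq_prod_range (fun k => w (X ((k + 1) * d) ω)) n

lemma IsMarkovChain.ae_tendsto_riemannSum (hX : IsMarkovChain μ X P π) (g : E → ℝ) {t : ℝ≥0}
    (ht : 0 < t) :
    ∀ᵐ ω ∂μ, Tendsto (fun n : ℕ => ∑ k ∈ Finset.range (n + 1),
      ((t / ((n : ℝ≥0) + 1) : ℝ≥0) : ℝ) * g (X ((k + 1) * (t / ((n : ℝ≥0) + 1))) ω)) atTop
      (𝓝 (∫ s in (0 : ℝ)..t, g (X s.toNNReal ω))) := by
  filter_upwards [hX.cadlag] with ω hω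
  have h := tendsto_riemannSum (u := fun s => g (X s.toNNReal ω)) (c := ∑ i, |g i|)
    (t := t) ht (fun s => Finset.single_le_sum (f := fun i => |g i|)
      (fun i _ => abs_nonneg _) (Finset.mem_univ _)) (fun s hs => by
      have h1 : Tendsto Real.toNNReal (𝓝[>] s) (𝓝[>] s.toNNReal) :=
        tendsto_nhdsWithin_iff.2 ⟨(continuous_real_toNNReal.tendsto s).mono_left
          nhdsWithin_le_nhds, eventually_mem_nhdsWithin.mono fun r hr =>
            (Real.toNNReal_lt_toNNReal_iff_of_nonneg hs).2 hr⟩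
      refine tendsto_const_nhds.congr' ?_
      filter_upwards [h1.eventually (hω.1 s.toNNReal)] with r hr
      rw [hr])
  refine h.congr fun n => Finset.sum_congr rfl fun k _ => ?_
  have : ((k : ℝ) + 1) * ((t : ℝ) / ((n : ℝ) + 1)) =
      (((k + 1) * (t / ((n : ℝ≥0) + 1)) : ℝ≥0) : ℝ) := by push_cast; rfl
  rw [this, Real.toNNReal_coe]
  push_cast
  rfl

variable [DecidableEq E]

/-- The Chernoff bound with a growth rate larger than that of the tilted generator. -/
lemma IsMarkovChain.measure_le_exp [IsProbabilityMeasure μ] (hX : IsMarkovChain μ X P π)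
    {Q : Matrix E E ℝ} (hQ : HasQMatrix P Q) (hπ : IsInvariantDistribution P π)
    (hpos : ∀ i, 0 < π i) {g : E → ℝ} {θ L L' : ℝ} (hθ : 0 ≤ θ) (hL : L < L')
    (hv : ∀ f, qForm Q π f f + θ * innerL2 π (fun i => (g i - mean π g) * f i) f ≤
      L * innerL2 π f f) {t : ℝ≥0} (ht : 0 < t) (ε : ℝ) :
    μ {ω | (1 / t) * (∫ s in (0 : ℝ)..t, g (X s.toNNReal ω)) - mean π g ≥ ε} ≤
      ENNReal.ofReal (Real.exp (t * L' - θ * (t * ε))) := by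
  set d : ℕ → ℝ≥0 := fun n => t / ((n : ℝ≥0) + 1) with hd
  have hnd : ∀ n : ℕ, ((n + 1 : ℕ) : ℝ) * (d n : ℝ) = t := fun n => by
    simp only [hd]; push_cast; field_simp
  set v : E → ℝ := fun i => θ * (g i - mean π g) with hvdef
  set W : ℕ → Ω → ℝ := fun n ω =>
    ∏ k ∈ Finset.range (n + 1), Real.exp (d n * v (X ((k + 1) * d n) ω)) with hW
  set U : ℕ → Ω → ENNReal := fun n ω =>
    ENNReal.ofReal (Real.exp (-(θ * (t * ε))) * W n ω) with hU
  have hXm : ∀ (s : ℝ≥0) (φ : E → ℝ), Measurable fun ω => φ (X s ω) := fun s φ => by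
    let _ : MeasurableSpace E := ⊤
    exact (measurable_from_top (f := φ)).comp (measurable_to_countable' (hX.measurable s))
  have hUm : ∀ n, Measurable (U n) := fun n =>
    ((Finset.measurable_fun_prod _ fun k _ => hXm _ fun i => Real.exp (d n * v i)).const_mul
      _).ennreal_ofReal
  have hUint : ∀ᶠ n in atTop, ∫⁻ ω, U n ω ∂μ ≤
      ENNReal.ofReal (Real.exp (t * L' - θ * (t * ε))) := by
    have hstep := eventually_weightedStep_le hQ hpos hL (v := v) fun f => by
      refine le_of_eq_of_le ?_ (hv f)
      congr 1
      simp only [innerL2, hvdef, Finset.mul_sum]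
      exact Finset.sum_congr rfl fun i _ => by ring
    filter_upwards [(tendsto_div_succ_nhdsGT ht).eventually hstep] with n hn
    have h1 := mean_iterate_weightedStep_le hπ.nonneg hπ.sum_eq_one (c := L' * d n)
      (fun f => by rw [← mul_assoc]; exact hn f) (n + 1)
    rw [← hX.integral_prod] at h1
    simp only [Pi.one_apply, mul_one] at h1
    rw [← ofReal_integral_eq_lintegral_ofReal
      ((hX.integrable_prod (d n) (fun i => Real.exp (d n * v i)) (n + 1)).const_mul _)
      (Eventually.of_forall fun ω => mul_nonneg (Real.exp_pos _).le
        (Finset.prod_nonneg fun k _ => (Real.exp_pos _).le)), integral_const_mul]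
    refine ENNReal.ofReal_le_ofReal ?_
    refine (mul_le_mul_of_nonneg_left h1 (Real.exp_pos _).le).trans_eq ?_
    rw [← Real.exp_add, mul_left_comm _ L', hnd]
    ring_nf
  -- Almost surely U n converges to exp(θ(∫ g(X_s) ds − tπ(g) − tε)), which is at least 1 on the
  -- event.
  have hsub : ∀ᵐ ω ∂μ, (1 / t) * (∫ s in (0 : ℝ)..t, g (X s.toNNReal ω)) - mean π g ≥ ε →
      1 ≤ liminf (fun n => U n ω) atTop := by
    filter_upwards [hX.ae_tendsto_riemannSum g ht] with ω hω hε
    have hlim : Tendsto (fun n => U n ω) atTop (𝓝 (ENNReal.ofReal (Real.exp (-(θ * (t * ε)))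
        * Real.exp (θ * ((∫ s in (0 : ℝ)..t, g (X s.toNNReal ω)) - t * mean π g))))) := by
      refine ENNReal.tendsto_ofReal (Tendsto.const_mul _ ?_)
      refine ((Real.continuous_exp.tendsto _).comp
        ((hω.sub_const (t * mean π g)).const_mul θ)).congr fun n => ?_
      simp only [hW, ← Real.exp_sum, Function.comp_apply]
      congr 1
      simp only [hvdef, mul_sub, Finset.sum_sub_distrib, Finset.sum_const, Finset.card_range,
        nsmul_eq_mul, Finset.mul_sum]
      congr 1
      · exact Finset.sum_congr rfl fun k _ => by ring
      · rw [← hnd n]; ring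
    rw [hlim.liminf_eq, ← Real.exp_add, ← ENNReal.ofReal_one]
    refine ENNReal.ofReal_le_ofReal (Real.one_le_exp ?_)
    have ht' : (0 : ℝ) < t := ht
    have h2 : t * ε ≤ (∫ s in (0 : ℝ)..t, g (X s.toNNReal ω)) - t * mean π g := by
      have := mul_le_mul_of_nonneg_left hε ht'.le
      rwa [mul_sub, ← mul_assoc, mul_one_div_cancel ht'.ne', one_mul] at this
    nlinarith [mul_le_mul_of_nonneg_left h2 hθ]
  -- Markov's inequality is applied to the lower limit; Fatou suffices as only an upper bound is
  -- needed.
  calc _ ≤ μ {ω | 1 ≤ liminf (fun n => U n ω) atTop} := measure_mono_ae hsub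
    _ ≤ ∫⁻ ω, liminf (fun n => U n ω) atTop ∂μ := by
      simpa using mul_meas_ge_le_lintegral (μ := μ) (Measurable.liminf hUm) 1
    _ ≤ liminf (fun n => ∫⁻ ω, U n ω ∂μ) atTop := lintegral_liminf_le hUm
    _ ≤ _ := by
      refine liminf_le_of_le (by isBoundedDefault) fun b hb => ?_
      obtain ⟨n, hn, hn'⟩ := (hb.and hUint).exists
      exact hn.trans hn'

/-- The chosen θ minimises θ²(b − a)²/(4l) − θε, with minimum −lε²/(b − a)². The limit L' ↓ L
removes the slack. A real l below the gap is used because the gap may be infinite. -/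
lemma IsMarkovChain.measure_le_of_le_spectralGap [IsProbabilityMeasure μ]
    (hX : IsMarkovChain μ X P π) (hP : IsTransitionFunction P)
    {Q : Matrix E E ℝ} (hQ : HasQMatrix P Q) (hπ : IsInvariantDistribution P π)
    (hpos : ∀ i, 0 < π i) {l : ℝ} (hl0 : 0 < l) (hl : (l : EReal) ≤ spectralGap P π)
    {a b : ℝ} (hab : a < b) {g : E → ℝ} (hg : ∀ i, g i ∈ Set.Icc a b) {t : ℝ≥0} (ht : 0 < t)
    {ε : ℝ} (hε : 0 < ε) :
    μ {ω | (1 / t) * (∫ s in (0 : ℝ)..t, g (X s.toNNReal ω)) - mean π g ≥ ε} ≤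
      ENNReal.ofReal (Real.exp (-(l * (t * ε ^ 2 / (b - a) ^ 2)))) := by
  have hba : 0 < b - a := sub_pos.2 hab
  set θ := 2 * l * ε / (b - a) ^ 2 with hθ
  set L := θ ^ 2 * (b - a) ^ 2 / (4 * l) with hL
  have hlim : Tendsto (fun L' : ℝ => ENNReal.ofReal (Real.exp (t * L' - θ * (t * ε)))) (𝓝[>] L)
      (𝓝 (ENNReal.ofReal (Real.exp (t * L - θ * (t * ε))))) := by
    refine ENNReal.tendsto_ofReal (Tendsto.mono_left ?_ nhdsWithin_le_nhds)
    exact Continuous.tendsto (by fun_prop) L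
  have hexp : -(l * (t * ε ^ 2 / (b - a) ^ 2)) = t * L - θ * (t * ε) := by
    rw [hL, hθ]; field_simp; ring
  rw [hexp]
  exact ge_of_tendsto hlim (eventually_mem_nhdsWithin.mono fun L' hL' =>
    hX.measure_le_exp hQ hπ hpos (by positivity) hL'
      (qForm_add_mul_le hP hQ hπ hpos hl0 hl hg θ) ht ε)

end CTMC

/-! ### The theorem, with the gap as an extended real -/

theorem mainTheorem3 {E Ω : Type*} [Fintype E] [DecidableEq E] [MeasurableSpace Ω]
    (μ : MeasureTheory.Measure Ω) [MeasureTheory.IsProbabilityMeasure μ]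
    (P : ℝ≥0 → Matrix E E ℝ) (Q : Matrix E E ℝ) (π : E → ℝ) (X : ℝ≥0 → Ω → E)
    (hP : CTMC.IsTransitionFunction P) (hQ : CTMC.HasQMatrix P Q)
    (hirr : CTMC.Irreducible P) (hπ : CTMC.IsInvariantDistribution P π)
    (hX : CTMC.IsMarkovChain μ X P π) :
    0 < CTMC.spectralGap P π ∧
      ∀ (a b : ℝ) (g : E → ℝ), a < b → (∀ i, g i ∈ Set.Icc a b) →
        ∀ t ε : ℝ, 0 < t → 0 < ε →
          μ {ω | (1 / t) * (∫ s in (0 : ℝ)..t, g (X s.toNNReal ω)) - CTMC.mean π g ≥ ε} ≤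
            EReal.exp (-(CTMC.spectralGap P π * ((t * ε ^ 2 / (b - a) ^ 2 : ℝ) : EReal))) := by
  have hgap := CTMC.spectralGap_pos hP hQ hirr hπ
  refine ⟨hgap, fun a b g hab hg t ε ht hε => ?_⟩
  have hba : 0 < b - a := sub_pos.2 hab
  have key : ∀ l : ℝ, 0 < l → (l : EReal) ≤ CTMC.spectralGap P π →
      μ {ω | (1 / t) * (∫ s in (0 : ℝ)..t, g (X s.toNNReal ω)) - CTMC.mean π g ≥ ε} ≤
        ENNReal.ofReal (Real.exp (-(l * (t * ε ^ 2 / (b - a) ^ 2)))) := by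
    lift t to ℝ≥0 using ht.le
    intro l hl0 hl
    exact hX.measure_le_of_le_spectralGap hP hQ hπ (hπ.pos hP.nonneg hirr) hl0 hl hab hg
      (NNReal.coe_pos.1 ht) hε
  have hc : 0 < t * ε ^ 2 / (b - a) ^ 2 := by positivity
  generalize t * ε ^ 2 / (b - a) ^ 2 = c at hc key ⊢
  generalize CTMC.spectralGap P π = G at hgap key ⊢
  induction G with
  | bot => simp at hgap
  | coe l =>
    rw [← EReal.coe_mul, ← EReal.coe_neg, EReal.exp_coe]
    exact key l (EReal.coe_pos.1 hgap) le_rfl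
  -- An infinite gap leaves the bound valid for every l > 0, and l → ∞ gives probability 0.
  | top =>
    rw [EReal.top_mul_coe_of_pos hc, EReal.neg_top, EReal.exp_bot]
    have hlim : Filter.Tendsto (fun l : ℝ => ENNReal.ofReal (Real.exp (-(l * c)))) Filter.atTop
        (𝓝 (ENNReal.ofReal 0)) :=
      ENNReal.tendsto_ofReal (Real.tendsto_exp_neg_atTop_nhds_zero.comp
        (Filter.tendsto_id.atTop_mul_const hc))
    rw [ENNReal.ofReal_zero] at hlim
    exact ge_of_tendsto hlim ((Filter.eventually_gt_atTop 0).mono fun l hl => key l hl le_top)
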